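/- **Setting.** Fix a countably infinite set $\mathcal N$ of names, each having a sort, with infinitely many names of every sort that occurs. A *permutation* is a sort-preserving bijection of $\mathcal N$ moving only finitely many names. For a set with an action of the permutations, a set of names $N$ *supports* $x$ if $\pi\cdot x=x$ for every $\pi$ fixing all members of $N$; a *nominal set* is such a set in which every element has a finite support; $\operatorname{supp}(x)$ is then its least finite support, and $N\# x$ means $N\cap\operatorname{supp}(x)=\emptyset$. For a finite set $N$ of names, $\langle N\rangle x$ is the class of $(N,x)$ under: $(N,x)=_\alpha(N',x')$ iff some $\pi$ has $\pi\cdot N=N'$, $\pi\cdot x=x'$ and $\pi(a)=a$ for all $a\in\operatorname{supp}(x)\setminus N$. A *nominal transition system* consists of nominal sets of states $P,Q$, state predicates $\varphi$ and actions $\alpha$; an equivariant relation $P\vdash\varphi$; an equivariant function $\operatorname{bn}$ assigning to each action $\alpha$ a finite set $\operatorname{bn}(\alpha)\subseteq\operatorname{supp}(\alpha)$; and an equivariant set $\rightarrow$ of pairs $(P,\langle N\rangle(\alpha,P'))$ such that $(P,\langle N\rangle(\alpha,P'))\in{\rightarrow}$ implies $\operatorname{bn}(\alpha)=N$. Write $P\xrightarrow{\alpha}P'$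 for $(P,\langle\operatorname{bn}(\alpha)\rangle(\alpha,P'))\in{\rightarrow}$. A *bisimulation* is a symmetric relation $R$ on states such that $R(P,Q)$ implies: (1) $P\vdash\varphi$ implies $Q\vdash\varphi$ for every $\varphi$; (2) whenever $\operatorname{bn}(\alpha)\# Q$ and $P\xrightarrow{\alpha}P'$, there is $Q'$ with $Q\xrightarrow{\alpha}Q'$ and $R(P',Q')$. Write $P\mathrel{\dot\sim}Q$ if $R(P,Q)$ for some bisimulation $R$. Let $\kappa$ be a cardinal with $\kappa>\aleph_0$ and $\kappa>|\text{states}|$. *Formulas* are generated by $$A ::= \bigwedge_{i\in I}A_i \mid \neg A\mid\varphi\mid\langle\alpha\rangle A,$$ where the set $\{A_i\mid i\in I\}$ must have cardinality $<\kappa$ and finite support, and $\operatorname{bn}(\alpha)$ is bound in $\langle\alpha\rangle A$ (formulas are identified up to nominal alpha-equivalence). *Validity* is defined by: $P\models\bigwedge_{i\in I}A_i$ iff $P\models A_i$ for all $i\in I$; $P\models\neg A$ iff not $P\models A$; $P\models\varphi$ iff $P\vdash\varphi$; and $P\models\langle\alpha\rangle A$ iff there is $P'$ with $P\xrightarrow{\alpha}P'$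 and $P'\models A$, where the representative $\langle\alpha\rangle A$ of the alpha-equivalence class is chosen such that $\operatorname{bn}(\alpha)\# P$. States $P,Q$ are *logically equivalent*, $P\mathrel{\dot=}Q$, if $P\models A\iff Q\models A$ for every formula $A$. **Theorem.** In every nominal transition system, for all states $P,Q$: if $P\mathrel{\dot=}Q$ then $P\mathrel{\dot\sim}Q$. -/

import Mathlib

open Cardinal

universe u v w

/-! ### Names, permutations, support -/

section Names

variable {N : Type v} {S : Type w}

/-- Name permutations: the sort-preserving bijections on names that move only finitely many
names. -/
def NamePerm (sort : N → S) : Subgroup (Equiv.Perm N) where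
  carrier := {π | (∀ a, sort (π a) = sort a) ∧ {a | π a ≠ a}.Finite}
  one_mem' := by simp
  mul_mem' := by
    rintro π ρ ⟨hπ, hπ'⟩ ⟨hρ, hρ'⟩
    refine ⟨fun a => by simp [hπ, hρ], (hπ'.union hρ').subset fun a ha => ?_⟩
    by_contra hc
    simp only [Set.mem_union, Set.mem_ofPred_eq, not_or, not_not] at hc
    exact ha (by simp [hc.1, hc.2])
  inv_mem' := by
    rintro π ⟨hπ, hπ'⟩
    refine ⟨fun a => by simpa using (hπ (π⁻¹ a)).symm, hπ'.subset fun a ha hc => ha ?_⟩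
    simpa using congrArg (π⁻¹ : Equiv.Perm N) hc.symm

/-- A nominal set: a set with an action of the name permutations in which every element is
supported by a finite set of names. -/
class NominalSet (sort : N → S) (X : Type u) extends MulAction (NamePerm sort) X where
  exists_finite_support : ∀ x : X, ∃ s : Finset N,
    MulAction.Supports (NamePerm sort) (s : Set N) x

variable (sort : N → S) {X : Type u} [MulAction (NamePerm sort) X]

/-- The support of `x`: the least finite set of names supporting `x`, written as the intersection
of all finite supporting sets. -/
def supp (x : X) : Set N :=
  {a | ∀ s : Finset N, MulAction.Supports (NamePerm sort) (s : Set N) x → a ∈ s}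

/-- `A # x`: every name in `A` is fresh for `x`. -/
def FreshFor (A : Finset N) (x : X) : Prop := ∀ a ∈ A, a ∉ supp sort x

variable {sort}

/-- The action of a permutation on a finite set of names: the direct image. -/
def permNames (π : NamePerm sort) (A : Finset N) : Finset N :=
  A.map (π : Equiv.Perm N).toEmbedding

theorem mem_permNames {π : NamePerm sort} {A : Finset N} {a : N} :
    a ∈ permNames π A ↔ π⁻¹ • a ∈ A := by
  simp only [permNames, Finset.mem_map]
  constructor
  · rintro ⟨b, hb, rfl⟩
    change π⁻¹ • (π • b) ∈ A
    rwa [inv_smul_smul]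
  · intro h
    exact ⟨_, h, smul_inv_smul π a⟩

theorem permNames_one (A : Finset N) : permNames (1 : NamePerm sort) A = A := by
  ext a; simp [mem_permNames]

theorem permNames_mul (π ρ : NamePerm sort) (A : Finset N) :
    permNames (π * ρ) A = permNames π (permNames ρ A) := by
  ext a; simp [mem_permNames, mul_smul]

theorem supports_permNames {π : NamePerm sort} {s : Finset N} {x : X}
    (h : MulAction.Supports (NamePerm sort) (s : Set N) x) :
    MulAction.Supports (NamePerm sort) (permNames π s : Set N) (π • x) := by
  intro ρ hρ
  have := h (π⁻¹ * ρ * π) (fun a ha => by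
    have h1 : ρ • π • a = π • a := hρ (by
      simpa [mem_permNames] using ha)
    rw [mul_smul, mul_smul, h1, inv_smul_smul])
  rw [mul_smul, mul_smul, inv_smul_eq_iff] at this
  exact this

theorem mem_supp_smul {π : NamePerm sort} {x : X} {a : N} :
    a ∈ supp sort (π • x) ↔ π⁻¹ • a ∈ supp sort x := by
  constructor
  · intro h s hs
    exact mem_permNames.1 (h _ (supports_permNames (π := π) hs))
  · intro h s hs
    have h1 := supports_permNames (π := π⁻¹) hs
    rw [inv_smul_smul] at h1
    simpa [mem_permNames] using h _ h1

variable (sort X)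

/-- Nominal alpha-equivalence of pairs `(A, x)` of a finite set of binding names and an element. -/
def nameAbsSetoid : Setoid (Finset N × X) where
  r p q := ∃ π : NamePerm sort, permNames π p.1 = q.1 ∧ π • p.2 = q.2 ∧
    ∀ a ∈ supp sort p.2, a ∉ p.1 → π • a = a
  iseqv := by
    refine ⟨fun p => ⟨1, permNames_one _, one_smul _ _, fun _ _ _ => one_smul _ _⟩, ?_, ?_⟩
    · rintro ⟨A, x⟩ ⟨B, y⟩ ⟨π, rfl, rfl, h⟩
      refine ⟨π⁻¹, ?_, inv_smul_smul _ _, fun a ha hA => ?_⟩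
      · simp [← permNames_mul, permNames_one]
      · have h1 := h _ (mem_supp_smul.1 ha) (fun hc => hA (mem_permNames.2 hc))
        rw [smul_inv_smul] at h1
        exact h1.symm
    · rintro ⟨A, x⟩ ⟨B, y⟩ ⟨C, z⟩ ⟨π, rfl, rfl, h⟩ ⟨ρ, rfl, rfl, h'⟩
      refine ⟨ρ * π, permNames_mul _ _ _, mul_smul _ _ _, fun a ha hA => ?_⟩
      have h1 : π • a = a := h a ha hA
      have h2 : π⁻¹ • a = a := inv_smul_eq_iff.2 h1.symm
      have h3 : ρ • a = a := h' a (mem_supp_smul.2 (by rwa [h2]))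
        (fun hc => hA (by simpa [h2] using mem_permNames.1 hc))
      rw [mul_smul, h1, h3]

/-- Generalised name abstraction: pairs `(A, x)` modulo nominal alpha-equivalence. -/
def NameAbs : Type (max u v) := Quotient (nameAbsSetoid sort X)

variable {X}

/-- The abstraction `⟨A⟩x`. -/
def nameAbs (A : Finset N) (x : X) : NameAbs sort X := Quotient.mk (nameAbsSetoid sort X) (A, x)

end Names

/-! ### Nominal transition systems and bisimilarity -/

/-- Nominal transition systems over the given nominal sets of states, state predicates and
actions. -/
structure NTS {N : Type v} {S : Type w} (sort : N → S) (State Pred Act : Type u)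
    [NominalSet sort State] [NominalSet sort Pred] [NominalSet sort Act] where
  /-- the relation `P ⊢ φ` -/
  holds : State → Pred → Prop
  holds_equivariant : ∀ (π : NamePerm sort) (P : State) (φ : Pred),
    holds P φ → holds (π • P) (π • φ)
  /-- the binding names of an action -/
  bn : Act → Finset N
  bn_equivariant : ∀ (π : NamePerm sort) (α : Act), bn (π • α) = permNames π (bn α)
  bn_subset : ∀ (α : Act), ∀ a ∈ bn α, a ∈ supp sort α
  /-- the transition relation, a set of pairs of a state and a residual -/
  trans : Set (State × NameAbs sort (Act × State))
  trans_equivariant : ∀ (π : NamePerm sort) (P : State) (A : Finset N) (α : Act) (Q : State),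
    (P, nameAbs sort A (α, Q)) ∈ trans →
      (π • P, nameAbs sort (permNames π A) (π • α, π • Q)) ∈ trans
  trans_bn : ∀ (P : State) (A : Finset N) (α : Act) (Q : State),
    (P, nameAbs sort A (α, Q)) ∈ trans → bn α = A

namespace NTS

variable {N : Type v} {S : Type w} {sort : N → S} {State Pred Act : Type u}
  [NominalSet sort State] [NominalSet sort Pred] [NominalSet sort Act]
  (T : NTS sort State Pred Act)

/-- `P —α→ P'`, the name abstraction of the residual being implicit. -/
def Step (P : State) (α : Act) (P' : State) : Prop :=
  (P, nameAbs sort (T.bn α) (α, P')) ∈ T.trans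

/-- Bisimulations. -/
structure IsBisimulation (R : State → State → Prop) : Prop where
  symm : ∀ P Q, R P Q → R Q P
  static_implication : ∀ P Q, R P Q → ∀ φ, T.holds P φ → T.holds Q φ
  simulation : ∀ P Q, R P Q → ∀ α P', FreshFor sort (T.bn α) Q → T.Step P α P' →
    ∃ Q', T.Step Q α Q' ∧ R P' Q'

/-- Bisimilarity `P ∼ Q`. -/
def Bisimilar (P Q : State) : Prop := ∃ R, T.IsBisimulation R ∧ R P Q

end NTS

/-! ### Formulas -/

/-- Raw formulas, in which binding names are not yet abstracted; conjunctions have fewer than `κ`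
conjuncts. -/
inductive RawFormula (κ : Cardinal.{u}) (Pred Act : Type u) : Type (u + 1)
  | conj (I : Type u) (hI : #I < κ) (f : I → RawFormula κ Pred Act) : RawFormula κ Pred Act
  | neg (R : RawFormula κ Pred Act) : RawFormula κ Pred Act
  | pred (φ : Pred) : RawFormula κ Pred Act
  | act (α : Act) (R : RawFormula κ Pred Act) : RawFormula κ Pred Act

namespace RawFormula

variable {κ : Cardinal.{u}} {Pred Act : Type u} {G : Type v} [Group G]
  [MulAction G Pred] [MulAction G Act]

/-- Permutations distribute over all constructors. -/
def perm (π : G) : RawFormula κ Pred Act → RawFormula κ Pred Act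
  | conj I hI f => conj I hI fun i => perm π (f i)
  | neg R => neg (perm π R)
  | pred φ => pred (π • φ)
  | act α R => act (π • α) (perm π R)

instance : MulAction G (RawFormula κ Pred Act) where
  smul := perm
  one_smul R := by
    change perm 1 R = R
    induction R <;> simp_all [perm]
  mul_smul π ρ R := by
    change perm (π * ρ) R = perm π (perm ρ R)
    induction R <;> simp_all [perm, mul_smul]

@[simp] protected theorem smul_conj (π : G) (I : Type u) (hI : #I < κ) (f : I → RawFormula κ Pred Act) :
    π • conj I hI f = conj I hI fun i => π • f i := rfl
@[simp] protected theorem smul_neg (π : G) (R : RawFormula κ Pred Act) : π • neg R = neg (π • R) := rfl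
@[simp] protected theorem smul_pred (π : G) (φ : Pred) :
    π • (pred φ : RawFormula κ Pred Act) = pred (π • φ) := rfl
@[simp] protected theorem smul_act (π : G) (α : Act) (R : RawFormula κ Pred Act) :
    π • act α R = act (π • α) (π • R) := rfl

/-- The height of the syntax tree. -/
noncomputable def rank : RawFormula κ Pred Act → Ordinal.{u}
  | conj _ _ f => ⨆ i, Order.succ (rank (f i))
  | neg R => Order.succ (rank R)
  | pred _ => 0
  | act _ R => Order.succ (rank R)

theorem rank_smul (π : G) (R : RawFormula κ Pred Act) : (π • R).rank = R.rank := by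
  induction R <;> simp_all [rank]

end RawFormula

namespace NTS

open RawFormula

variable {N : Type v} {S : Type w} {sort : N → S} {State Pred Act : Type u}
  [NominalSet sort State] [NominalSet sort Pred] [NominalSet sort Act]
  (T : NTS sort State Pred Act) {κ : Cardinal.{u}}

/-- Given the equivalence class `C` of `R`, the support of `C`: the intersection of all finite sets
`s` of names such that every permutation fixing `s` pointwise maps `R` into `C`. -/
def classSupp (C : Set (RawFormula κ Pred Act)) (R : RawFormula κ Pred Act) : Set N :=
  {a | ∀ s : Finset N, (∀ π : NamePerm sort, (∀ b ∈ s, π • b = b) → π • R ∈ C) → a ∈ s}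

/-- Alpha-equivalence. Conjunctions are compared as sets of equivalence classes; `act α R` and
`act β R'` are equivalent if some permutation `π` that fixes the names in the support of `α` and in
the support of the class of `R`, except those in `bn α`, maps `α` to `β` and the class of `R` to
the class of `R'` (for structural recursion, this is written with `π⁻¹` on the side of `R'`). -/
def Alpha : RawFormula κ Pred Act → RawFormula κ Pred Act → Prop
  | conj I _ f, conj J _ g =>
      (∀ i : I, ∃ j : J, Alpha (f i) (g j)) ∧ (∀ j : J, ∃ i : I, Alpha (f i) (g j))
  | neg R, neg R' => Alpha R R'
  | pred φ, pred ψ => φ = ψ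
  | act α R, act β R' => ∃ π : NamePerm sort, π • α = β ∧ Alpha R (π⁻¹ • R') ∧
      ∀ a, a ∈ supp sort α ∨ a ∈ classSupp (sort := sort) {R'' | Alpha R R''} R →
        a ∉ T.bn α → π • a = a
  | _, _ => False

theorem conj_smul_fixes {π σ : NamePerm sort} {s : Finset N}
    (hσ : ∀ b ∈ permNames π s, σ • b = b) : ∀ b ∈ s, (π⁻¹ * σ * π) • b = b := by
  intro b hb
  have h1 : σ • π • b = π • b := hσ _ (by simpa [mem_permNames] using hb)
  rw [mul_smul, mul_smul, h1, inv_smul_smul]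

theorem mem_bn_smul {π : NamePerm sort} {α : Act} {a : N} :
    a ∈ T.bn (π • α) ↔ π⁻¹ • a ∈ T.bn α := by
  rw [T.bn_equivariant, mem_permNames]

variable {T}

theorem Alpha.smul {R R' : RawFormula κ Pred Act} (h : T.Alpha R R') (π : NamePerm sort) :
    T.Alpha (π • R) (π • R') := by
  induction R generalizing R' π with
  | conj I hI f ih =>
    cases R' <;> simp only [Alpha, RawFormula.smul_conj] at h ⊢
    exact ⟨fun i => (h.1 i).imp fun j hj => ih i hj π, fun j => (h.2 j).imp fun i hi => ih i hi π⟩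
  | neg R ih =>
    cases R' <;> simp only [Alpha, RawFormula.smul_neg] at h ⊢
    exact ih h π
  | pred φ =>
    cases R' <;> simp only [Alpha, RawFormula.smul_pred] at h ⊢
    rw [h]
  | act α R ih =>
    cases R' <;> simp only [Alpha, RawFormula.smul_act] at h ⊢
    obtain ⟨τ, rfl, h1, h2⟩ := h
    refine ⟨π * τ * π⁻¹, by simp [mul_smul], ?_, fun a ha hb => ?_⟩
    · have := ih h1 π
      simpa [mul_smul] using this
    · have h3 : τ • π⁻¹ • a = π⁻¹ • a := by
        refine h2 _ (ha.imp mem_supp_smul.1 fun hc s hs => ?_) fun hc => hb (T.mem_bn_smul.2 hc)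
        refine mem_permNames.1 (hc (permNames π s) fun σ hσ => ?_)
        have := ih (hs _ (conj_smul_fixes hσ)) π
        simpa [mul_smul] using this
      rw [mul_smul, mul_smul, h3, smul_inv_smul]

theorem alpha_smul_iff {R R' : RawFormula κ Pred Act} {π : NamePerm sort} :
    T.Alpha (π • R) (π • R') ↔ T.Alpha R R' :=
  ⟨fun h => by simpa using h.smul π⁻¹, fun h => h.smul π⟩

theorem alpha_equiv_aux (R : RawFormula κ Pred Act) :
    T.Alpha R R ∧ ∀ X, T.Alpha R X → ∀ Y, (T.Alpha R Y ↔ T.Alpha X Y) := by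
  induction R with
  | conj I hI f ih =>
    refine ⟨⟨fun i => ⟨i, (ih i).1⟩, fun i => ⟨i, (ih i).1⟩⟩, fun X hX Y => ?_⟩
    cases X <;> simp only [Alpha] at hX
    cases Y <;> simp only [Alpha]
    constructor
    · rintro ⟨h1, h2⟩
      refine ⟨fun j => ?_, fun k => ?_⟩
      · obtain ⟨i, hi⟩ := hX.2 j
        exact (h1 i).imp fun k hk => ((ih i).2 _ hi _).1 hk
      · obtain ⟨i, hi⟩ := h2 k
        exact (hX.1 i).imp fun j hj => ((ih i).2 _ hj _).1 hi
    · rintro ⟨h1, h2⟩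
      refine ⟨fun i => ?_, fun k => ?_⟩
      · obtain ⟨j, hj⟩ := hX.1 i
        exact (h1 j).imp fun k hk => ((ih i).2 _ hj _).2 hk
      · obtain ⟨j, hj⟩ := h2 k
        exact (hX.2 j).imp fun i hi => ((ih i).2 _ hi _).2 hj
  | neg R ih =>
    refine ⟨ih.1, fun X hX Y => ?_⟩
    cases X <;> simp only [Alpha] at hX
    cases Y <;> simp only [Alpha]
    exact ih.2 _ hX _
  | pred φ =>
    refine ⟨rfl, fun X hX Y => ?_⟩
    cases X <;> simp only [Alpha] at hX
    cases Y <;> simp only [Alpha]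
    rw [hX]
  | act α R ih =>
    obtain ⟨ih1, ih2⟩ := ih
    refine ⟨⟨1, one_smul _ _, by simpa using ih1, fun _ _ _ => one_smul _ _⟩, fun X hX Y => ?_⟩
    cases X <;> simp only [Alpha] at hX
    rename_i β R'
    obtain ⟨π, rfl, h1, h2⟩ := hX
    cases Y <;> simp only [Alpha]
    rename_i γ R''
    obtain ⟨X, rfl⟩ : ∃ X, R' = π • X := ⟨π⁻¹ • R', by simp⟩
    rw [inv_smul_smul] at h1
    have hXR : T.Alpha X R := (ih2 _ h1 _).1 ih1
    have key : ∀ a, a ∈ classSupp (sort := sort) {Z | T.Alpha (π • X) Z} (π • X) ↔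
        π⁻¹ • a ∈ classSupp (sort := sort) {Z | T.Alpha R Z} R := by
      intro a
      constructor
      · intro hc s hs
        refine mem_permNames.1 (hc (permNames π s) fun σ hσ => ?_)
        have h3 : T.Alpha R ((π⁻¹ * σ * π) • R) := hs _ (conj_smul_fixes hσ)
        have h4 := ((ih2 _ h3 _).2 (h1.smul _))
        have h5 := ((ih2 _ h1 _).1 h4).smul π
        simpa [mul_smul] using h5
      · intro hc s hs
        have h6 := hc (permNames π⁻¹ s) fun σ hσ => ?_
        · simpa [mem_permNames] using h6
        have h3 : T.Alpha (π • X) ((π * σ * π⁻¹) • π • X) :=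
          hs _ (by simpa using conj_smul_fixes hσ)
        have h4 : T.Alpha X (σ • X) := by simpa [mul_smul] using h3.smul π⁻¹
        have h5 : T.Alpha R (σ • X) := (ih2 _ h1 _).2 h4
        exact (ih2 _ h5 _).2 (hXR.smul σ)
    constructor
    · rintro ⟨ρ, rfl, h3, h4⟩
      refine ⟨ρ * π⁻¹, by simp [mul_smul], ?_, fun a ha hb => ?_⟩
      · have := ((ih2 _ h1 _).1 h3).smul π
        simpa [mul_smul] using this
      · have ha' := ha.imp mem_supp_smul.1 (key a).1
        have hb' : π⁻¹ • a ∉ T.bn α := fun hc => hb (T.mem_bn_smul.2 hc)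
        have h5 := h2 _ ha' hb'
        rw [mul_smul, h4 _ ha' hb', ← h5, smul_inv_smul]
    · rintro ⟨ρ, rfl, h3, h4⟩
      refine ⟨ρ * π, by simp [mul_smul], ?_, fun a ha hb => ?_⟩
      · refine (ih2 _ h1 _).2 ?_
        have := h3.smul π⁻¹
        simpa [mul_smul] using this
      · have h5 := h2 a ha hb
        have h6 : π⁻¹ • a = a := inv_smul_eq_iff.2 h5.symm
        rw [mul_smul, h5]
        refine h4 a (ha.imp (fun h => mem_supp_smul.2 (by rwa [h6])) fun h => (key a).2 (by rwa [h6]))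
          fun hc => hb ?_
        simpa [h6] using T.mem_bn_smul.1 hc

theorem Alpha.refl (R : RawFormula κ Pred Act) : T.Alpha R R := (alpha_equiv_aux R).1

theorem Alpha.symm {R R' : RawFormula κ Pred Act} (h : T.Alpha R R') : T.Alpha R' R :=
  ((alpha_equiv_aux R).2 _ h _).1 (Alpha.refl R)

theorem Alpha.trans {R R' R'' : RawFormula κ Pred Act} (h : T.Alpha R R') (h' : T.Alpha R' R'') :
    T.Alpha R R'' :=
  ((alpha_equiv_aux R).2 _ h _).2 h'

theorem Alpha.rank_eq {R R' : RawFormula κ Pred Act} (h : T.Alpha R R') : R.rank = R'.rank := by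
  induction R generalizing R' with
  | conj I hI f ih =>
    cases R' <;> simp only [Alpha] at h
    simp only [rank]
    refine le_antisymm (Ordinal.iSup_le fun i => ?_) (Ordinal.iSup_le fun j => ?_)
    · obtain ⟨j, hj⟩ := h.1 i
      rw [ih i hj]
      exact Ordinal.le_iSup (fun j => Order.succ (rank _)) j
    · obtain ⟨i, hi⟩ := h.2 j
      rw [← ih i hi]
      exact Ordinal.le_iSup (fun i => Order.succ (rank (f i))) i
  | neg R ih =>
    cases R' <;> simp only [Alpha] at h
    simp only [rank, ih h]
  | pred φ =>
    cases R' <;> simp only [Alpha] at h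
    rfl
  | act α R ih =>
    cases R' <;> simp only [Alpha] at h
    obtain ⟨π, -, h, -⟩ := h
    simp only [rank, ih h, rank_smul]

variable (T)

/-- A raw formula denotes a formula if every conjunction in it, as a set of classes of formulas,
has finite support. -/
def WellFormed : RawFormula κ Pred Act → Prop
  | conj I hI f => (∀ i, WellFormed (f i)) ∧
      ∃ s : Finset N, ∀ π : NamePerm sort, (∀ a ∈ s, π • a = a) →
        T.Alpha (conj I hI f) (π • conj I hI f)
  | neg R => WellFormed R
  | pred _ => True
  | act _ R => WellFormed R

/-- Alpha-equivalence of well-formed raw formulas. -/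
def formulaSetoid (κ : Cardinal.{u}) : Setoid {R : RawFormula κ Pred Act // T.WellFormed R} where
  r R R' := T.Alpha R.1 R'.1
  iseqv := ⟨fun _ => Alpha.refl _, Alpha.symm, Alpha.trans⟩

/-- The formulas of the logic. -/
def Formula (κ : Cardinal.{u}) : Type (u + 1) := Quotient (T.formulaSetoid κ)

/-- Validity of a raw formula in a state. In the last clause, `act β R'` is a representative of
the alpha-equivalence class of `act α R` with `bn β # P`. -/
def RawValid (P : State) : RawFormula κ Pred Act → Prop
  | conj _ _ f => ∀ i, RawValid P (f i)
  | neg R => ¬ RawValid P R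
  | pred φ => T.holds P φ
  | act α R => ∃ (β : Act) (R' : RawFormula κ Pred Act) (_ : T.Alpha (act α R) (act β R')),
      FreshFor sort (T.bn β) P ∧ ∃ P', T.Step P β P' ∧ RawValid P' R'
termination_by R => R.rank
decreasing_by
  · simp only [rank]
    exact Order.succ_le_iff.1 (Ordinal.le_iSup (fun i => Order.succ (rank (f i))) _)
  · simp only [rank]
    exact Order.lt_succ _
  · have := (‹T.Alpha (act α R) (act β R')›).rank_eq
    simp only [rank] at this ⊢
    rw [this]
    exact Order.lt_succ _

variable {T} in
theorem rawValid_congr {R R' : RawFormula κ Pred Act} (h : T.Alpha R R') (P : State) :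
    T.RawValid P R ↔ T.RawValid P R' := by
  induction R generalizing R' P with
  | conj I hI f ih =>
    cases R' <;> simp only [Alpha] at h
    simp only [RawValid]
    constructor
    · intro h' j
      obtain ⟨i, hi⟩ := h.2 j
      exact (ih i hi P).1 (h' i)
    · intro h' i
      obtain ⟨j, hj⟩ := h.1 i
      exact (ih i hj P).2 (h' j)
  | neg R ih =>
    cases R' <;> simp only [Alpha] at h
    simp only [RawValid, ih h P]
  | pred φ =>
    cases R' <;> simp only [Alpha] at h
    rw [h]
  | act α R ih =>
    cases R' with
    | act β X =>
      simp only [RawValid]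
      exact ⟨fun ⟨β, X, hX, h'⟩ => ⟨β, X, h.symm.trans hX, h'⟩,
        fun ⟨β, X, hX, h'⟩ => ⟨β, X, h.trans hX, h'⟩⟩
    | _ => simp only [Alpha] at h

/-- Validity `P ⊨ A`. -/
def Valid (P : State) (A : T.Formula κ) : Prop :=
  Quotient.liftOn A (fun R => T.RawValid P R.1) fun _ _ h => propext (rawValid_congr h P)

/-- Logical equivalence `P ≐ Q`. -/
def LogEquiv (κ : Cardinal.{u}) (P Q : State) : Prop :=
  ∀ A : T.Formula κ, T.Valid P A ↔ T.Valid Q A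

end NTS

/-! Logical equivalence is itself a bisimulation. Suppose `P ≐ Q` and `P —α→ P'`, but no
`α`-successor `Q'` of `Q` is equivalent to `P'`. Pick for each `Q'` a formula true at `P'` and false
at `Q'`. If their conjunction is a formula, prefixing it with `α` gives a formula true at `P`, hence
at `Q`, so some `Q'` satisfies its own distinguishing formula: a contradiction.

There are fewer than `κ` conjuncts because `#State < κ`. Finite support is the real issue: arbitrary
choices have no common support. In `exists_distinguishing_formula` each choice is replaced by the
conjunction of its translates under all permutations fixing a finite support `s` of `P'`. These are
countably many, hence fewer than `κ`; all hold at `P'` by equivariance; and the result is supported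
by `s`, the same for every `Q'`.

Bound names cause two detours. If `bn α` is not fresh for `P`, the transition is first renamed and
the answer renamed back (`LogEquiv.simulation`). Validity at `Q` may use another representative of
the prefixed formula, and `RawValid.exists_step` returns to `α`. Both need `supp`, defined as an
intersection, to be a support; `mem_of_fixes_least` gives this for elements and for alpha-classes
alike. -/

section Names

variable {N : Type v} {S : Type w} {sort : N → S}

/-! ### Finite permutations: countability and fresh renamings -/

namespace NamePerm

theorem inv_smul_fixes {π : NamePerm sort} {a : N} (h : π • a = a) : π⁻¹ • a = a :=
  inv_smul_eq_iff.2 h.symm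

/-- A permutation is determined by its graph over the finitely many names it moves. -/
instance [Countable N] : Countable (NamePerm sort) := by
  classical
  have hfin (π : NamePerm sort) : {a | (π : Equiv.Perm N) a ≠ a}.Finite := π.2.2
  let F (π : NamePerm sort) : Finset (N × N) :=
    (hfin π).toFinset.image fun a => (a, (π : Equiv.Perm N) a)
  refine Function.Injective.countable (f := F) fun π ρ h => ?_
  have key : ∀ (π ρ : NamePerm sort), F π = F ρ → ∀ a, (π : Equiv.Perm N) a ≠ a →
      (ρ : Equiv.Perm N) a = (π : Equiv.Perm N) a := by
    intro π ρ h a ha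
    have h1 : (a, (π : Equiv.Perm N) a) ∈ F ρ := by
      rw [← h]
      exact Finset.mem_image.2 ⟨a, by simpa using ha, rfl⟩
    obtain ⟨b, -, hb⟩ := Finset.mem_image.1 h1
    simp only [Prod.mk.injEq] at hb
    obtain ⟨rfl, hb⟩ := hb
    exact hb
  refine Subtype.ext (Equiv.ext fun a => ?_)
  by_cases ha : (π : Equiv.Perm N) a = a
  · by_contra hne
    exact hne (key ρ π h.symm a fun hc => hne (ha.trans hc.symm))
  · exact (key π ρ h a ha).symm

end NamePerm

/-- A finite set of names can be injectively renamed, respecting sorts, to avoid a finite set. -/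
theorem exists_fresh_renaming (hsort : ∀ a : N, {b : N | sort b = sort a}.Infinite)
    (A F : Finset N) :
    ∃ f : N → N, Set.InjOn f A ∧ ∀ a ∈ A, sort (f a) = sort a ∧ f a ∉ F := by
  classical
  induction A using Finset.induction_on with
  | empty => exact ⟨id, by simp, by simp⟩
  | insert a A ha ih =>
    obtain ⟨f, hf, hf'⟩ := ih
    obtain ⟨c, hc, hcF⟩ := (hsort a).exists_notMem_finset (F ∪ A.image f)
    simp only [Finset.mem_union, not_or] at hcF
    have hupd : ∀ b ∈ A, Function.update f a c b = f b := fun b hb =>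
      Function.update_of_ne (ne_of_mem_of_not_mem hb ha) _ _
    refine ⟨Function.update f a c, ?_, fun b hb => ?_⟩
    · rw [Finset.coe_insert, Set.injOn_insert (by simpa using ha)]
      refine ⟨fun b hb b' hb' h => hf hb hb' ?_, ?_⟩
      · rwa [hupd b hb, hupd b' hb'] at h
      · rintro ⟨b, hb, h⟩
        rw [hupd b hb, Function.update_self] at h
        exact hcF.2 (Finset.mem_image.2 ⟨b, hb, h⟩)
    · rcases Finset.mem_insert.1 hb with rfl | hb
      · simpa using ⟨hc, hcF.1⟩
      · rw [hupd b hb]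
        exact hf' b hb

/-- An injective sort-preserving renaming of a finite set to a disjoint one extends to an
involution that exchanges the two sets and fixes all other names. -/
theorem exists_exchange (A : Finset N) (f : N → N) (hf : Set.InjOn f A)
    (hs : ∀ a ∈ A, sort (f a) = sort a) (hd : ∀ a ∈ A, f a ∉ A) :
    ∃ τ : NamePerm sort, (∀ a ∈ A, τ • a = f a) ∧ (∀ a ∈ A, τ • f a = a) ∧
      ∀ b, b ∉ A → (∀ a ∈ A, f a ≠ b) → τ • b = b := by
  classical
  let g : N → N := fun b =>
    if b ∈ A then f b else if h : ∃ a ∈ A, f a = b then h.choose else b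
  have g1 : ∀ a ∈ A, g a = f a := fun a ha => if_pos ha
  have g2 : ∀ a ∈ A, g (f a) = a := by
    intro a ha
    have h : ∃ a' ∈ A, f a' = f a := ⟨a, ha, rfl⟩
    simp only [g, if_neg (hd a ha), dif_pos h]
    exact hf h.choose_spec.1 ha h.choose_spec.2
  have g3 : ∀ b, b ∉ A → (∀ a ∈ A, f a ≠ b) → g b = b := by
    intro b hb h
    have h' : ¬ ∃ a ∈ A, f a = b := by simpa using h
    simp only [g, if_neg hb, dif_neg h']
  have cases (b : N) : b ∈ A ∨ (∃ a ∈ A, f a = b) ∨ (b ∉ A ∧ ∀ a ∈ A, f a ≠ b) := by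
    by_cases hb : b ∈ A
    · exact .inl hb
    · by_cases h : ∃ a ∈ A, f a = b
      · exact .inr (.inl h)
      · exact .inr (.inr ⟨hb, by simpa using h⟩)
  have hg : Function.Involutive g := by
    intro b
    rcases cases b with hb | ⟨a, ha, rfl⟩ | ⟨hb, h⟩
    · rw [g1 b hb, g2 b hb]
    · rw [g2 a ha, g1 a ha]
    · rw [g3 b hb h, g3 b hb h]
  refine ⟨⟨hg.toPerm, fun b => ?_, ?_⟩, g1, g2, g3⟩
  · change sort (g b) = sort b
    rcases cases b with hb | ⟨a, ha, rfl⟩ | ⟨hb, h⟩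
    · rw [g1 b hb, hs b hb]
    · rw [g2 a ha, hs a ha]
    · rw [g3 b hb h]
  · refine (A ∪ A.image f).finite_toSet.subset fun b hb => ?_
    by_contra hc
    simp only [Finset.coe_union, Finset.coe_image, Set.mem_union, Finset.mem_coe, Set.mem_image,
      not_or, not_exists, not_and] at hc
    exact hb (g3 b hc.1 hc.2)

/-- A finite set of names can be exchanged with a set of names avoiding a finite set. -/
theorem exists_fresh_exchange (hsort : ∀ a : N, {b : N | sort b = sort a}.Infinite)
    (A F : Finset N) :
    ∃ τ : NamePerm sort, (∀ a ∈ A, τ • a ∉ F) ∧ (∀ a ∈ A, τ • τ • a = a) ∧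
      ∀ b, b ∉ A → (∀ a ∈ A, τ • a ≠ b) → τ • b = b := by
  classical
  -- Avoiding `A` as well makes the image disjoint from `A`, so that the two sets can be exchanged.
  obtain ⟨f, hf, hf'⟩ := exists_fresh_renaming hsort A (A ∪ F)
  simp only [Finset.mem_union, not_or] at hf'
  obtain ⟨τ, h1, h2, h3⟩ := exists_exchange A f hf (fun a ha => (hf' a ha).1)
    (fun a ha => (hf' a ha).2.1)
  refine ⟨τ, fun a ha => ?_, fun a ha => ?_, fun b hb h => h3 b hb fun a ha => ?_⟩
  · rw [h1 a ha]
    exact (hf' a ha).2.2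
  · rw [h1 a ha, h2 a ha]
  · rw [← h1 a ha]
    exact h a ha

/-- A permutation can be replaced by one that agrees with it on `A`, and that fixes all names
outside of `A`, its image, and a set of names avoiding a finite set. -/
theorem exists_restricted_perm (hsort : ∀ a : N, {b : N | sort b = sort a}.Infinite)
    (A F : Finset N) (π : NamePerm sort) :
    ∃ ρ : NamePerm sort, (∀ a ∈ A, ρ • a = π • a) ∧
      ∀ b ∈ F, b ∉ A → b ∉ permNames π A → ρ • b = b := by
  classical
  -- `A` and its image under `π` may overlap, so they cannot be exchanged directly. The route goes
  -- through a fresh copy of `A`, disjoint from both `F` and the image.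
  obtain ⟨τ, h1, h2, h3⟩ := exists_fresh_exchange hsort A (F ∪ permNames π A)
  simp only [Finset.mem_union, not_or] at h1
  have hmem : ∀ a ∈ A, π • a ∈ permNames π A := fun a ha => by simpa [mem_permNames] using ha
  have hsmul (ρ : NamePerm sort) (a : N) : sort (ρ • a) = sort a := ρ.2.1 a
  -- exchange the fresh copy of `A` with the image of `A`
  obtain ⟨σ, k1, -, k3⟩ := exists_exchange (sort := sort) (permNames τ A) (fun c => π • τ⁻¹ • c)
    (fun c _ c' _ h => by simpa using h) (fun c _ => by simp only [hsmul]) (by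
      intro c hc hc'
      rw [mem_permNames] at hc
      have h4 := (h1 _ (mem_permNames.1 hc')).2
      rw [smul_inv_smul] at h4
      exact h4 (hmem _ hc))
  refine ⟨σ * τ, fun a ha => ?_, fun b hbF hbA hbπ => ?_⟩
  · rw [mul_smul, k1 _ (by simpa [mem_permNames] using ha), inv_smul_smul]
  · have hb : τ • b = b := h3 b hbA fun a ha h => (h1 a ha).1 (h ▸ hbF)
    rw [mul_smul, hb]
    refine k3 b (fun h => ?_) (fun c hc h => hbπ (h ▸ hmem _ (mem_permNames.1 hc)))
    rw [mem_permNames] at h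
    have h4 := (h1 _ h).1
    rw [smul_inv_smul] at h4
    exact h4 hbF

/-! ### Least supports -/

/-- If a subgroup contains the pointwise fixators of two finite sets of names, it contains that of
their intersection. -/
theorem fixator_inter_le [DecidableEq N] (hsort : ∀ a : N, {b : N | sort b = sort a}.Infinite)
    (H : Subgroup (NamePerm sort)) {s t : Finset N}
    (hs : ∀ π : NamePerm sort, (∀ a ∈ s, π • a = a) → π ∈ H)
    (ht : ∀ π : NamePerm sort, (∀ a ∈ t, π • a = a) → π ∈ H)
    (π : NamePerm sort) (hπ : ∀ a ∈ s ∩ t, π • a = a) : π ∈ H := by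
  have hM : {a | (π : Equiv.Perm N) a ≠ a}.Finite := π.2.2
  -- `τ` sends `s \ t` to names that `π` does not move, and it fixes `t`. Hence `τ ∈ H`, while `τ *
  -- π * τ⁻¹` fixes `s`, so it lies in `H` too; conjugating back gives `π ∈ H`.
  obtain ⟨τ, h1, h2, h3⟩ := exists_fresh_exchange hsort (s \ t) (s ∪ t ∪ hM.toFinset)
  simp only [Finset.mem_union, not_or, Set.Finite.mem_toFinset, Set.mem_ofPred_eq, not_not] at h1
  have hτ : τ ∈ H := by
    refine ht τ fun b hb => h3 b (fun hc => (Finset.mem_sdiff.1 hc).2 hb) fun a ha h => ?_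
    exact (h1 a ha).1.2 (h ▸ hb)
  have hconj : τ * π * τ⁻¹ ∈ H := by
    refine hs _ fun b hb => ?_
    rw [mul_smul, mul_smul, smul_eq_iff_eq_inv_smul]
    by_cases hbt : b ∈ t
    · have hb' : τ⁻¹ • b = b := by
        refine NamePerm.inv_smul_fixes (h3 b (fun hc => (Finset.mem_sdiff.1 hc).2 hbt) ?_)
        intro a ha h
        exact (h1 a ha).1.2 (h ▸ hbt)
      rw [hb', hπ b (Finset.mem_inter.2 ⟨hb, hbt⟩)]
    · have hbd : b ∈ s \ t := Finset.mem_sdiff.2 ⟨hb, hbt⟩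
      have hb' : τ⁻¹ • b = τ • b := inv_smul_eq_iff.2 (h2 b hbd).symm
      rw [hb']
      exact (h1 b hbd).2
  simpa [mul_assoc] using H.mul_mem (H.mul_mem (H.inv_mem hτ) hconj) hτ

/-- A subgroup that contains the pointwise fixator of a finite set of names contains that of the
intersection of all such sets. -/
theorem mem_of_fixes_least (hsort : ∀ a : N, {b : N | sort b = sort a}.Infinite)
    (H : Subgroup (NamePerm sort)) {s : Finset N}
    (hs : ∀ π : NamePerm sort, (∀ a ∈ s, π • a = a) → π ∈ H) (π : NamePerm sort)
    (hπ : ∀ a, (∀ t : Finset N, (∀ ρ : NamePerm sort, (∀ b ∈ t, ρ • b = b) → ρ ∈ H) → a ∈ t) →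
      π • a = a) : π ∈ H := by
  classical
  -- A set `t` of least cardinality is contained in every other such set `r`, since `t ∩ r` also
  -- qualifies. So `t` is the intersection of them all.
  have hex : ∃ n, ∃ t : Finset N, t.card = n ∧
      ∀ ρ : NamePerm sort, (∀ b ∈ t, ρ • b = b) → ρ ∈ H := ⟨_, s, rfl, hs⟩
  obtain ⟨t, ht, htH⟩ := Nat.find_spec hex
  refine htH π fun a ha => hπ a fun r hr => ?_
  have h1 := Nat.find_min' hex ⟨_, rfl, fixator_inter_le hsort H htH hr⟩
  rw [← ht] at h1
  exact (Finset.mem_inter.1 ((Finset.eq_of_subset_of_card_le Finset.inter_subset_left h1).symm ▸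
    ha : a ∈ t ∩ r)).2

variable {X : Type u}

/-- The case of a stabilizer: the intersection of all finite supports is again a support. -/
theorem smul_eq_of_fixes_supp [NominalSet sort X]
    (hsort : ∀ a : N, {b : N | sort b = sort a}.Infinite) (x : X) {π : NamePerm sort}
    (hπ : ∀ a ∈ supp sort x, π • a = a) : π • x = x := by
  obtain ⟨s, hs⟩ := NominalSet.exists_finite_support (sort := sort) x
  refine mem_of_fixes_least hsort (MulAction.stabilizer (NamePerm sort) x) (s := s)
    (fun ρ hρ => hs ρ fun a ha => hρ a ha) π fun a ha => hπ a fun t ht => ?_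
  exact ha t fun ρ hρ => ht ρ fun b hb => hρ b hb

theorem FreshFor.smul [MulAction (NamePerm sort) X] {A : Finset N} {x : X}
    (h : FreshFor sort A x) (π : NamePerm sort) : FreshFor sort (permNames π A) (π • x) :=
  fun _ ha hc => h _ (mem_permNames.1 ha) (mem_supp_smul.1 hc)

theorem nameAbs_smul [MulAction (NamePerm sort) X] {A : Finset N} {x : X} {π : NamePerm sort}
    (h : ∀ a ∈ supp sort x, a ∉ A → π • a = a) :
    nameAbs sort (permNames π A) (π • x) = nameAbs sort A x :=
  (Quotient.sound ⟨π, rfl, rfl, h⟩ : nameAbs sort A x = _).symm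

end Names

/-! ### Equivariance of transitions, well-formedness and validity -/

namespace NTS

open RawFormula

variable {N : Type v} {S : Type w} {sort : N → S} {State Pred Act : Type u}
  [NominalSet sort State] [NominalSet sort Pred] [NominalSet sort Act]
  {T : NTS sort State Pred Act} {κ : Cardinal.{u}}

theorem Step.smul {P P' : State} {α : Act} (h : T.Step P α P') (π : NamePerm sort) :
    T.Step (π • P) (π • α) (π • P') := by
  rw [Step, T.bn_equivariant]
  exact T.trans_equivariant π P _ α P' h

/-- Renaming the bound names of a transition. -/
theorem Step.rename {P P' : State} {α : Act} (h : T.Step P α P') {π : NamePerm sort}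
    (hπ : ∀ a ∈ supp sort (α, P'), a ∉ T.bn α → π • a = a) : T.Step P (π • α) (π • P') := by
  have h1 : nameAbs sort (permNames π (T.bn α)) (π • α, π • P') =
      nameAbs sort (T.bn α) (α, P') := nameAbs_smul hπ
  rw [Step, T.bn_equivariant, h1]
  exact h

theorem WellFormed.smul {R : RawFormula κ Pred Act} (h : T.WellFormed R) (π : NamePerm sort) :
    T.WellFormed (π • R) := by
  induction R with
  | conj I hI f ih =>
    obtain ⟨h1, s, hs⟩ := h
    refine ⟨fun i => ih i (h1 i), permNames π s, fun σ hσ => ?_⟩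
    have h2 := (hs _ (conj_smul_fixes hσ)).smul π
    rw [← mul_smul] at h2
    change T.Alpha (π • conj I hI f) (σ • π • conj I hI f)
    rw [← mul_smul]
    convert h2 using 2
    group
  | neg R ih => exact ih h
  | pred φ => trivial
  | act α R ih => exact ih h

/-- The induction is on rank because the action clause passes to the body of another representative,
which has the right rank but is not a subterm. Negation uses the induction hypothesis for `π⁻¹`. -/
theorem RawValid.smul {P : State} {R : RawFormula κ Pred Act} (h : T.RawValid P R)
    (π : NamePerm sort) : T.RawValid (π • P) (π • R) := by
  induction hr : R.rank using WellFoundedLT.induction generalizing P R π with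
  | ind r ih =>
    subst hr
    cases R with
    | conj I hI f =>
      simp only [RawFormula.smul_conj, RawValid] at h ⊢
      refine fun i => ih _ ?_ (h i) π rfl
      simp only [rank]
      exact Order.succ_le_iff.1 (Ordinal.le_iSup (fun i => Order.succ (rank (f i))) _)
    | neg R =>
      simp only [RawFormula.smul_neg, RawValid] at h ⊢
      refine fun hc => h ?_
      simpa using ih R.rank (by simp only [rank]; exact Order.lt_succ _) hc π⁻¹ (rank_smul π R)
    | pred φ =>
      simp only [RawFormula.smul_pred, RawValid] at h ⊢
      exact T.holds_equivariant π P φ h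
    | act α R =>
      simp only [RawFormula.smul_act, RawValid] at h ⊢
      obtain ⟨β, R', hα, hβ, P', hP', hR'⟩ := h
      refine ⟨π • β, π • R', by simpa using hα.smul π, ?_, π • P', hP'.smul π, ?_⟩
      · rw [T.bn_equivariant]
        exact hβ.smul π
      · refine ih R'.rank ?_ hR' π rfl
        have := hα.rank_eq
        simp only [rank] at this ⊢
        rw [this]
        exact Order.lt_succ _

/-! ### Logical equivalence and distinguishing formulas -/

theorem LogEquiv.symm {P Q : State} (h : T.LogEquiv κ P Q) : T.LogEquiv κ Q P :=
  fun A => (h A).symm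

theorem LogEquiv.rawValid_iff {P Q : State} (h : T.LogEquiv κ P Q) {R : RawFormula κ Pred Act}
    (hR : T.WellFormed R) : T.RawValid P R ↔ T.RawValid Q R :=
  h (Quotient.mk (T.formulaSetoid κ) ⟨R, hR⟩)

/-- The converse implication comes from applying the hypothesis to negations. -/
theorem logEquiv_of_rawValid_imp {P Q : State}
    (h : ∀ R : RawFormula κ Pred Act, T.WellFormed R → T.RawValid P R → T.RawValid Q R) :
    T.LogEquiv κ P Q := by
  intro A
  induction A using Quotient.inductionOn with
  | h R =>
    refine ⟨h R.1 R.2, fun hQ => ?_⟩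
    by_contra hP
    have := h (neg R.1) R.2
    simp only [RawValid] at this
    exact this hP hQ

theorem LogEquiv.smul {P Q : State} (h : T.LogEquiv κ P Q) (π : NamePerm sort) :
    T.LogEquiv κ (π • P) (π • Q) := by
  refine logEquiv_of_rawValid_imp fun R hR hP => ?_
  have h1 := ((h.rawValid_iff (hR.smul π⁻¹)).1 (by simpa using hP.smul π⁻¹)).smul π
  simpa using h1

/-- Logically inequivalent states are distinguished by a formula supported by any finite support of
the state that satisfies it. -/
theorem exists_distinguishing_formula [Countable N] (hκ : ℵ₀ < κ) {P Q : State}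
    (h : ¬ T.LogEquiv κ P Q) {s : Finset N} (hs : ∀ π : NamePerm sort, (∀ a ∈ s, π • a = a) →
      π • P = P) :
    ∃ R : RawFormula κ Pred Act, T.WellFormed R ∧ T.RawValid P R ∧ ¬ T.RawValid Q R ∧
      ∀ π : NamePerm sort, (∀ a ∈ s, π • a = a) → T.Alpha R (π • R) := by
  obtain ⟨R, hR, hP, hQ⟩ : ∃ R : RawFormula κ Pred Act,
      T.WellFormed R ∧ T.RawValid P R ∧ ¬ T.RawValid Q R := by
    by_contra! hc
    exact h (logEquiv_of_rawValid_imp hc)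
  -- The new formula is the conjunction of the orbit of `R` under `G`. Elements of `G` fix `P` and
  -- merely permute this orbit.
  let G := {π : NamePerm sort // ∀ a ∈ s, π • a = a}
  have : Nonempty G := ⟨⟨1, fun a _ => one_smul _ a⟩⟩
  obtain ⟨e, he⟩ := exists_surjective_nat G
  have hI : #(ULift.{u} ℕ) < κ := by simpa using hκ
  let f : ULift.{u} ℕ → RawFormula κ Pred Act := fun n => (e n.down).1 • R
  have hsupp : ∀ π : NamePerm sort, (∀ a ∈ s, π • a = a) →
      T.Alpha (conj _ hI f) (π • conj _ hI f) := by
    intro π hπ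
    refine ⟨fun i => ?_, fun i => ?_⟩
    · obtain ⟨j, hj⟩ := he ⟨π⁻¹ * (e i.down).1, fun a ha => by
        rw [mul_smul, (e i.down).2 a ha, NamePerm.inv_smul_fixes (hπ a ha)]⟩
      refine ⟨⟨j⟩, ?_⟩
      change T.Alpha ((e i.down).1 • R) (π • (e j).1 • R)
      rw [hj, mul_smul, smul_inv_smul]
      exact Alpha.refl _
    · obtain ⟨j, hj⟩ := he ⟨π * (e i.down).1, fun a ha => by
        rw [mul_smul, (e i.down).2 a ha, hπ a ha]⟩
      refine ⟨⟨j⟩, ?_⟩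
      change T.Alpha ((e j).1 • R) (π • (e i.down).1 • R)
      rw [hj, mul_smul]
      exact Alpha.refl _
  refine ⟨conj _ hI f, ⟨fun i => hR.smul _, s, hsupp⟩, ?_, fun hc => hQ ?_, hsupp⟩
  · simp only [RawValid]
    intro i
    have h1 := hP.smul (e i.down).1
    rwa [hs _ (e i.down).2] at h1
  · simp only [RawValid] at hc
    -- The identity contributes `R` itself as a conjunct, and `R` fails at `Q`.
    obtain ⟨j, hj⟩ := he ⟨1, fun a _ => one_smul _ a⟩
    have h1 := hc ⟨j⟩
    simpa only [f, hj, one_smul] using h1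

/-- The permutations that fix the class of a raw formula. -/
def alphaStabilizer (T : NTS sort State Pred Act) (R : RawFormula κ Pred Act) :
    Subgroup (NamePerm sort) where
  carrier := {π | T.Alpha R (π • R)}
  one_mem' := by simpa using Alpha.refl R
  mul_mem' := by
    intro π ρ hπ hρ
    have h1 : T.Alpha R (π • ρ • R) := Alpha.trans hπ (Alpha.smul hρ π)
    rwa [← mul_smul] at h1
  inv_mem' := by
    intro π hπ
    have h1 := (Alpha.smul hπ π⁻¹).symm
    rwa [inv_smul_smul] at h1

/-- If a state has a transition to a state satisfying a finitely supported formula `R` under some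
representative of the class of `act α R`, and the bound names of `α` are fresh for the state as
well, then it has such a transition under `act α R` itself. -/
theorem RawValid.exists_step (hsort : ∀ a : N, {b : N | sort b = sort a}.Infinite) {Q : State}
    {α : Act} {R : RawFormula κ Pred Act} {s : Finset N}
    (hs : ∀ π : NamePerm sort, (∀ a ∈ s, π • a = a) → T.Alpha R (π • R))
    (hα : FreshFor sort (T.bn α) Q) (h : T.RawValid Q (act α R)) :
    ∃ Q', T.Step Q α Q' ∧ T.RawValid Q' R := by
  classical
  simp only [RawValid] at h
  obtain ⟨β, R', hαβ, hβ, Q', hQ', hR'⟩ := h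
  simp only [Alpha] at hαβ
  obtain ⟨π, rfl, hR, hπ⟩ := hαβ
  obtain ⟨sα, hsα⟩ := NominalSet.exists_finite_support (sort := sort) α
  obtain ⟨sQ, hsQ⟩ := NominalSet.exists_finite_support (sort := sort) Q
  -- `π` may move names of `Q`. Its replacement `ρ` has the same effect on `α` and on the class of
  -- `R`, yet fixes `Q`.
  obtain ⟨ρ, hρ, hρ'⟩ := exists_restricted_perm hsort (T.bn α) (sα ∪ sQ ∪ s) π
  rw [T.bn_equivariant] at hβ
  -- `ρ` agrees with `π` on the supports of `α` and of the class of `R`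
  have hagree : ∀ a, a ∈ sα ∪ sQ ∪ s →
      a ∈ supp sort α ∨ a ∈ classSupp (sort := sort) {R'' | T.Alpha R R''} R →
      (ρ⁻¹ * π) • a = a := by
    intro a ha ha'
    rw [mul_smul, inv_smul_eq_iff]
    by_cases hb : a ∈ T.bn α
    · exact (hρ a hb).symm
    · have h1 := hπ a ha' hb
      rw [h1, hρ' a ha hb]
      -- A name fixed by `π` and outside `bn α` is also outside the image of `bn α`.
      rw [mem_permNames, NamePerm.inv_smul_fixes h1]
      exact hb
  have hρα : (ρ⁻¹ * π) • α = α := smul_eq_of_fixes_supp hsort α fun a ha =>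
    hagree a (by simp [ha sα hsα]) (.inl ha)
  have hρR : (ρ⁻¹ * π) ∈ T.alphaStabilizer R := by
    refine mem_of_fixes_least hsort (T.alphaStabilizer R) (s := s) hs _ fun a ha => ?_
    exact hagree a (by simp [ha s hs]) (.inr ha)
  have hρQ : ρ • Q = Q := smul_eq_of_fixes_supp hsort Q fun a ha =>
    hρ' a (by simp [ha sQ hsQ]) (fun hc => hα a hc ha) fun hc => hβ a hc ha
  -- Translating by `ρ⁻¹` turns the step under `π • α` into a step of `Q` under `α`.
  have h1 := hQ'.smul ρ⁻¹
  rw [inv_smul_eq_iff.2 hρQ.symm, ← mul_smul, hρα] at h1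
  refine ⟨_, h1, (rawValid_congr (R' := ρ⁻¹ • R') ?_ _).2 (hR'.smul ρ⁻¹)⟩
  have h2 : T.Alpha R ((ρ⁻¹ * π) • R) := hρR
  have h3 := hR.smul (ρ⁻¹ * π)
  rw [mul_smul, mul_smul, smul_inv_smul, ← mul_smul] at h3
  exact h2.trans h3

/-! ### Logical equivalence is a bisimulation -/

theorem LogEquiv.simulation_of_fresh [Countable N]
    (hsort : ∀ a : N, {b : N | sort b = sort a}.Infinite) (hκ : ℵ₀ < κ) (hκ' : #State < κ)
    {P Q P' : State} {α : Act} (h : T.LogEquiv κ P Q) (hαP : FreshFor sort (T.bn α) P)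
    (hαQ : FreshFor sort (T.bn α) Q) (hP' : T.Step P α P') :
    ∃ Q', T.Step Q α Q' ∧ T.LogEquiv κ P' Q' := by
  by_contra! hc
  obtain ⟨s, hs⟩ := NominalSet.exists_finite_support (sort := sort) P'
  -- One `s` supports every `B Q'`, so it supports their conjunction.
  choose B hB hBP hBQ hBs using fun Q' : {Q' // T.Step Q α Q'} =>
    exists_distinguishing_formula hκ (hc Q'.1 Q'.2) (s := s) fun π hπ => hs π fun a ha => hπ a ha
  have hI : #{Q' // T.Step Q α Q'} < κ := (mk_subtype_le _).trans_lt hκ'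
  have hsupp : ∀ π : NamePerm sort, (∀ a ∈ s, π • a = a) →
      T.Alpha (conj _ hI B) (π • conj _ hI B) := fun π hπ =>
    ⟨fun i => ⟨i, hBs i π hπ⟩, fun i => ⟨i, hBs i π hπ⟩⟩
  have hwf : T.WellFormed (act α (conj _ hI B)) := ⟨hB, s, hsupp⟩
  have hP : T.RawValid P (act α (conj _ hI B)) := by
    simp only [RawValid]
    -- Freshness of `bn α` for `P` lets `α` serve as its own representative.
    refine ⟨α, _, Alpha.refl _, hαP, P', hP', ?_⟩
    simpa only [RawValid] using hBP
  obtain ⟨Q', hQ', hv⟩ := ((h.rawValid_iff hwf).1 hP).exists_step hsort hsupp hαQ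
  simp only [RawValid] at hv
  exact hBQ ⟨Q', hQ'⟩ (hv ⟨Q', hQ'⟩)

/-- Exchanging `bn α` with fresh names does not affect the transition of `P`, since only bound names
of the residual change, and fixes `Q`, since `bn α` is fresh for `Q`. The matching step of `Q` can
thus be carried back by `τ⁻¹`, as logical equivalence is equivariant. -/
theorem LogEquiv.simulation [Countable N]
    (hsort : ∀ a : N, {b : N | sort b = sort a}.Infinite) (hκ : ℵ₀ < κ) (hκ' : #State < κ)
    {P Q P' : State} {α : Act} (h : T.LogEquiv κ P Q) (hα : FreshFor sort (T.bn α) Q)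
    (hP' : T.Step P α P') : ∃ Q', T.Step Q α Q' ∧ T.LogEquiv κ P' Q' := by
  classical
  obtain ⟨sα, hsα⟩ := NominalSet.exists_finite_support (sort := sort) α
  obtain ⟨sP, hsP⟩ := NominalSet.exists_finite_support (sort := sort) P
  obtain ⟨sQ, hsQ⟩ := NominalSet.exists_finite_support (sort := sort) Q
  obtain ⟨sP', hsP'⟩ := NominalSet.exists_finite_support (sort := sort) P'
  obtain ⟨τ, h1, -, h3⟩ := exists_fresh_exchange hsort (T.bn α) (sα ∪ sP ∪ sQ ∪ sP')
  have hfix : ∀ b ∈ sα ∪ sP ∪ sQ ∪ sP', b ∉ T.bn α → τ • b = b := fun b hb hbα =>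
    h3 b hbα fun a ha hab => h1 a ha (hab ▸ hb)
  have hfresh : ∀ b ∈ T.bn (τ • α), b ∉ sα ∪ sP ∪ sQ ∪ sP' := by
    intro b hb
    have h2 := h1 _ (T.mem_bn_smul.1 hb)
    rwa [smul_inv_smul] at h2
  have hpair : MulAction.Supports (NamePerm sort) ((sα ∪ sP' : Finset N) : Set N) (α, P') := by
    intro π hπ
    refine Prod.ext (hsα π fun a ha => hπ ?_) (hsP' π fun a ha => hπ ?_)
    · exact Finset.mem_union_left _ ha
    · exact Finset.mem_union_right _ ha
  have hstep : T.Step P (τ • α) (τ • P') := by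
    refine hP'.rename fun a ha hb => hfix a ?_ hb
    have := ha _ hpair
    simp only [Finset.mem_union] at this ⊢
    tauto
  have hτQ : τ • Q = Q := smul_eq_of_fixes_supp hsort Q fun a ha =>
    hfix a (by simp [ha sQ hsQ]) fun hc => hα a hc ha
  obtain ⟨Q', hQ', hPQ⟩ := h.simulation_of_fresh hsort hκ hκ'
    (fun b hb hc => hfresh b hb (by simp [hc sP hsP]))
    (fun b hb hc => hfresh b hb (by simp [hc sQ hsQ])) hstep
  refine ⟨τ⁻¹ • Q', ?_, by simpa using hPQ.smul τ⁻¹⟩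
  simpa [inv_smul_eq_iff.2 hτQ.symm] using hQ'.smul τ⁻¹

theorem isBisimulation_logEquiv [Countable N]
    (hsort : ∀ a : N, {b : N | sort b = sort a}.Infinite) (hκ : ℵ₀ < κ) (hκ' : #State < κ) :
    T.IsBisimulation (T.LogEquiv κ) where
  symm _ _ h := h.symm
  static_implication P Q h φ hφ := by
    have h1 := h.rawValid_iff (R := pred φ) trivial
    simp only [RawValid] at h1
    exact h1.1 hφ
  simulation _ _ h _ _ hα hP' := h.simulation hsort hκ hκ' hα hP'

end NTS

theorem mainTheorem1 {N : Type v} [Countable N] [Infinite N] {S : Type w} (sort : N → S)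
    (hsort : ∀ a : N, {b : N | sort b = sort a}.Infinite)
    {State Pred Act : Type u}
    [NominalSet sort State] [NominalSet sort Pred] [NominalSet sort Act]
    (T : NTS sort State Pred Act)
    (κ : Cardinal.{u}) (hκ : ℵ₀ < κ) (hκ' : #State < κ)
    (P Q : State) (h : T.LogEquiv κ P Q) : T.Bisimilar P Q :=
  ⟨_, NTS.isBisimulation_logEquiv hsort hκ hκ', h⟩
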